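/- For integers $n,k\ge 0$ with $n\ge k-1$, let $A_{n,k}$ be the set of truncated anti-lecture hall compositions, i.e. of sequences $\lambda=(\lambda_1,\dots,\lambda_k)$ of nonnegative integers with $$\frac{\lambda_1}{n-k+1}\ge\frac{\lambda_2}{n-k+2}\ge\cdots\ge\frac{\lambda_k}{n}\ge 0,$$ where, if $n=k-1$, the first inequality (whose left-hand side has denominator $0$) imposes no condition. Write $|\lambda_o|=\lambda_1+\lambda_3+\cdots$ and $|\lambda_e|=\lambda_2+\lambda_4+\cdots$, and put $(a;q)_m=\prod_{i=0}^{m-1}(1-aq^i)$ and $\begin{bmatrix} n\\ m\end{bmatrix}_q=(q^{n-m+1};q)_m/(q;q)_m$. Then, as formal power series in $x$ and $y$, $$\sum_{\lambda\in A_{n,k}}x^{|\lambda_o|}y^{|\lambda_e|}=\frac{\begin{bmatrix} n\\ \lfloor k/2\rfloor\end{bmatrix}_{xy}}{(x;xy)_{\lceil k/2\rceil}\,(x^{n-k+1}y^{n-k+2};xy)_{\lfloor k/2\rfloor}}.$$ In particular, for every $n\ge 0$, the set $A_n$ of anti-lecture hall compositions, i.e. of sequences $(\lambda_1,\dots,\lambda_n)$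 of nonnegative integers with $\frac{\lambda_1}{1}\ge\frac{\lambda_2}{2}\ge\cdots\ge\frac{\lambda_n}{n}\ge 0$, satisfies $$\sum_{\lambda\in A_{n}}x^{|\lambda_o|}y^{|\lambda_e|}=\frac{\begin{bmatrix} n\\ \lfloor n/2\rfloor\end{bmatrix}_{xy}}{(x;xy)_{\lceil n/2\rceil}\,(xy^{2};xy)_{\lfloor n/2\rfloor}}.$$ -/

import Mathlib

/-- The set `A_{n,k}` of truncated anti-lecture hall compositions (meaningful for `k ≤ n + 1`):
sequences `l 0, …, l (k-1)` of nonnegative integers (0-based indexing) with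
`l 0 / (n-k+1) ≥ l 1 / (n-k+2) ≥ … ≥ l (k-1) / n ≥ 0`.
An inequality whose left-hand denominator is zero (only the first one, when `n = k - 1`) imposes
no condition. -/
def truncAntiLectureHall (n k : ℕ) : Set (Fin k → ℕ) :=
  {l | ∀ i j : Fin k, (j : ℕ) = (i : ℕ) + 1 → (n : ℚ) - k + 1 + (i : ℕ) ≠ 0 →
    (l j : ℚ) / ((n : ℚ) - k + 1 + (j : ℕ)) ≤ (l i : ℚ) / ((n : ℚ) - k + 1 + (i : ℕ))}

/-- The set `A_n` of anti-lecture hall compositions: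
`l 0 / 1 ≥ l 1 / 2 ≥ … ≥ l (n-1) / n ≥ 0`. -/
def antiLectureHall (n : ℕ) : Set (Fin n → ℕ) :=
  {l | ∀ i j : Fin n, (j : ℕ) = (i : ℕ) + 1 →
    (l j : ℚ) / ((j : ℕ) + 1) ≤ (l i : ℚ) / ((i : ℕ) + 1)}

/-- `|λ_o| = λ_1 + λ_3 + ⋯`, the parts of odd 1-based index, i.e. of even 0-based index. -/
def oddWeight {k : ℕ} (l : Fin k → ℕ) : ℕ :=
  ∑ i : Fin k, if (i : ℕ) % 2 = 0 then l i else 0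

/-- `|λ_e| = λ_2 + λ_4 + ⋯`, the parts of even 1-based index, i.e. of odd 0-based index. -/
def evenWeight {k : ℕ} (l : Fin k → ℕ) : ℕ :=
  ∑ i : Fin k, if (i : ℕ) % 2 = 1 then l i else 0

/-- Only finitely many sequences have given odd and even weight. -/
theorem finite_setOf_weights {k : ℕ} (S : Set (Fin k → ℕ)) (a b : ℕ) :
    {l | l ∈ S ∧ oddWeight l = a ∧ evenWeight l = b}.Finite := by
  refine (Set.finite_Iic (fun _ : Fin k => a + b)).subset ?_
  rintro l ⟨-, rfl, rfl⟩ i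
  have ho := Finset.single_le_sum (f := fun i : Fin k => if (i : ℕ) % 2 = 0 then l i else 0)
    (fun _ _ => Nat.zero_le _) (Finset.mem_univ i)
  have he := Finset.single_le_sum (f := fun i : Fin k => if (i : ℕ) % 2 = 1 then l i else 0)
    (fun _ _ => Nat.zero_le _) (Finset.mem_univ i)
  simp only [oddWeight, evenWeight]
  rcases Nat.mod_two_eq_zero_or_one (i : ℕ) with h | h
  · simp only [h, if_true] at ho
    omega
  · simp only [h, if_true] at he
    omega

/-- The formal power series `∑_{λ ∈ S} x^{|λ_o|} y^{|λ_e|}`, where `x` is the variable `0` and `y`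
the variable `1`: the coefficient of `x^a y^b` is the (finite) number of `λ ∈ S` with
`|λ_o| = a` and `|λ_e| = b`. -/
noncomputable def oddEvenGF {k : ℕ} (S : Set (Fin k → ℕ)) : MvPowerSeries (Fin 2) ℚ :=
  fun m => ({l | l ∈ S ∧ oddWeight l = m 0 ∧ evenWeight l = m 1}.ncard : ℚ)

/-- `(a;q)_m = ∏_{i=0}^{m-1} (1 - a q^i)`. -/
def qPoch {R : Type*} [CommRing R] (a q : R) (m : ℕ) : R :=
  ∏ i ∈ Finset.range m, (1 - a * q ^ i)

/-- The Gaussian polynomial `[n choose m]_q = (q^{n-m+1};q)_m / (q;q)_m`, evaluated at a power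
series `q` without constant term, so that `(q;q)_m` is invertible. -/
noncomputable def gaussBinom (n m : ℕ) (q : MvPowerSeries (Fin 2) ℚ) : MvPowerSeries (Fin 2) ℚ :=
  qPoch (q ^ (n + 1 - m)) q m * (qPoch q q m)⁻¹

/-- The formal variable `x`. -/
noncomputable def xVar : MvPowerSeries (Fin 2) ℚ := MvPowerSeries.X 0

/-- The formal variable `y`. -/
noncomputable def yVar : MvPowerSeries (Fin 2) ℚ := MvPowerSeries.X 1

/-! Put `q = xy`, `a = n + 1 - k`, and let F(a, k) be the generating function of `ratioSeqs a k`,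
where the inequalities are cleared of denominators; when a = 0 the first of them is automatically
vacuous. The product formulas for F(a, 2r) and F(a, 2r+1) are proved together by recursion.

The main tool is a reflection. In a sequence of even length for a + 1, the entries of odd index can
vary independently once those of even index are fixed, each in an interval determined by its two
neighbours. Reflecting each in its interval and prepending the least admissible first entry gives a
sequence for a, one longer, with minimal first entry (`reflectCons_bijOn`). Since the two interval
endpoints attached to a value v add up to 2v, the weights change linearly: the substitution is x ↦
x²y, y ↦ x⁻¹, which fixes q and sends x^(a+1)y^(a+2) to x^a y^(a+1).

Raising the first entry freely accounts for a factor 1/(1-x), so F(a+1, 2r) determines F(a, 2r+1).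
For even lengths, raising the last entry gives (1-y)F(a, 2r+2) = F(a, 2r+1) - yM(a), with M counting
sequences whose last entry is maximal. Reflection relates M(a+1) to (1-x)F(a, 2r+2), giving an
induction on a. It starts at a = 0, where a minimal first entry is 0 and deleting it exchanges x and
y. -/

/-! ### Extremal numerators allowed by a neighbouring ratio. -/

/-- The smallest numerator `u` such that `v / d ≤ u / (d - 1)`. -/
def lowerNum (d v : ℕ) : ℕ := v - v / d

/-- The largest numerator `w` such that `w / (d + 1) ≤ v / d`. -/
def upperNum (d v : ℕ) : ℕ := v + v / d

theorem lowerNum_zero (d : ℕ) : lowerNum d 0 = 0 := by simp [lowerNum]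

theorem upperNum_zero (d : ℕ) : upperNum d 0 = 0 := by simp [upperNum]

theorem lowerNum_add_upperNum (d v : ℕ) : lowerNum d v + upperNum d v = 2 * v := by
  have := Nat.div_le_self v d
  simp only [lowerNum, upperNum]
  omega

/-- The least numerator is the ceiling of vd/(d+1). The case d = 0 is included and yields 0, whereas
for `upperNum` a zero denominator would leave no upper bound. -/
theorem lowerNum_le_iff (d u v : ℕ) : lowerNum (d + 1) v ≤ u ↔ v * d ≤ u * (d + 1) := by
  rw [lowerNum, tsub_le_iff_tsub_le, Nat.le_div_iff_mul_le (Nat.succ_pos d)]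
  rcases le_total v u with h | h
  · rw [Nat.sub_eq_zero_of_le h]
    have : v * d ≤ u * (d + 1) := Nat.mul_le_mul h (Nat.le_succ d)
    simp [this]
  · obtain ⟨w, rfl⟩ := Nat.exists_eq_add_of_le h
    rw [Nat.add_sub_cancel_left]
    constructor <;> intro h' <;> nlinarith

theorem le_upperNum_iff {d : ℕ} (hd : 0 < d) (v w : ℕ) :
    w ≤ upperNum d v ↔ w * d ≤ v * (d + 1) := by
  have : upperNum d v = v * (d + 1) / d := by
    rw [upperNum, mul_add, mul_one, mul_comm v d, Nat.mul_add_div hd]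
  rw [this, Nat.le_div_iff_mul_le hd]

/-! ### Sequences with decreasing ratios and the reflection bijection. -/

/-- Sequences `l` supported on `{0, …, k - 1}` with `l i / (a + i)` weakly decreasing. -/
def ratioSeqs (a k : ℕ) : Set (ℕ → ℕ) :=
  {l | (∀ i, l (i + 1) * (a + i) ≤ l i * (a + i + 1)) ∧ ∀ i, k ≤ i → l i = 0}

theorem lowerNum_le_of_mem {a k : ℕ} {l : ℕ → ℕ} (hl : l ∈ ratioSeqs a k) (i : ℕ) :
    lowerNum (a + i + 1) (l (i + 1)) ≤ l i :=
  (lowerNum_le_iff _ _ _).2 (hl.1 i)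

theorem le_upperNum_of_mem {a k : ℕ} {l : ℕ → ℕ} (hl : l ∈ ratioSeqs a k) {i : ℕ}
    (h : 0 < a + i) : l (i + 1) ≤ upperNum (a + i) (l i) :=
  (le_upperNum_iff h _ _).2 (hl.1 i)

/-- Elements of `ratioSeqs a k` whose first entry is as small as the second one allows. -/
def minSeqs (a k : ℕ) : Set (ℕ → ℕ) :=
  {l | l ∈ ratioSeqs a k ∧ l 0 = lowerNum (a + 1) (l 1)}

/-- Elements of `ratioSeqs a (j + 2)` whose last entry is as large as the previous one allows. -/
def maxSeqs (a j : ℕ) : Set (ℕ → ℕ) :=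
  {l | l ∈ ratioSeqs a (j + 2) ∧ l (j + 1) = upperNum (a + j) (l j)}

/-- The sum of the first `R` entries of even index. -/
def evenIndexSum (R : ℕ) (l : ℕ → ℕ) : ℕ := ∑ i ∈ Finset.range R, l (2 * i)

/-- The sum of the first `R` entries of odd index. -/
def oddIndexSum (R : ℕ) (l : ℕ → ℕ) : ℕ := ∑ i ∈ Finset.range R, l (2 * i + 1)

/-- Reflect every even-indexed entry of positive index in the interval allowed by its neighbours
and prepend the smallest possible first entry. -/
def reflectCons (a : ℕ) (l : ℕ → ℕ) (j : ℕ) : ℕ :=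
  if j = 0 then lowerNum (a + 1) (l 0)
  else if j % 2 = 1 then l (j - 1)
  else upperNum (a + j - 1) (l (j - 2)) + lowerNum (a + j + 1) (l j) - l (j - 1)

/-- Delete the first entry and reflect every even-indexed entry in the interval allowed by its
neighbours. -/
def reflectTail (a : ℕ) (l : ℕ → ℕ) (j : ℕ) : ℕ :=
  if j % 2 = 0 then l (j + 1)
  else upperNum (a + j) (l j) + lowerNum (a + j + 2) (l (j + 2)) - l (j + 1)

theorem reflectCons_zero (a : ℕ) (l : ℕ → ℕ) : reflectCons a l 0 = lowerNum (a + 1) (l 0) := by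
  simp [reflectCons]

theorem reflectCons_odd (a : ℕ) (l : ℕ → ℕ) (i : ℕ) : reflectCons a l (2 * i + 1) = l (2 * i) := by
  have h : (2 * i + 1) % 2 = 1 := by omega
  simp [reflectCons, h]

theorem reflectCons_even (a : ℕ) (l : ℕ → ℕ) (i : ℕ) : reflectCons a l (2 * i + 2) =
    upperNum (a + 1 + 2 * i) (l (2 * i)) + lowerNum (a + 1 + (2 * i + 2)) (l (2 * i + 2))
      - l (2 * i + 1) := by
  have h : (2 * i + 2) % 2 ≠ 1 := by omega
  have h1 : a + (2 * i + 2) - 1 = a + 1 + 2 * i := by omega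
  have h2 : a + (2 * i + 2) + 1 = a + 1 + (2 * i + 2) := by omega
  simp [reflectCons, h1, h2]

theorem reflectTail_even (a : ℕ) (l : ℕ → ℕ) (i : ℕ) :
    reflectTail a l (2 * i) = l (2 * i + 1) := by
  simp [reflectTail]

theorem reflectTail_odd (a : ℕ) (l : ℕ → ℕ) (i : ℕ) : reflectTail a l (2 * i + 1) =
    upperNum (a + 1 + 2 * i) (l (2 * i + 1)) + lowerNum (a + 1 + (2 * i + 2)) (l (2 * i + 3))
      - l (2 * i + 2) := by
  have h : (2 * i + 1) % 2 ≠ 0 := by omega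
  have h1 : a + (2 * i + 1) = a + 1 + 2 * i := by omega
  have h2 : a + 1 + 2 * i + 2 = a + 1 + (2 * i + 2) := by omega
  simp [reflectTail, h1, h2]

theorem reflectCons_mem {a r : ℕ} {l : ℕ → ℕ} (hl : l ∈ ratioSeqs (a + 1) (2 * r)) :
    reflectCons a l ∈ minSeqs a (2 * r + 1) := by
  refine ⟨⟨fun i => ?_, fun i hi => ?_⟩, ?_⟩
  · obtain ⟨i, rfl | rfl⟩ := Nat.even_or_odd' i
    · rw [← lowerNum_le_iff, reflectCons_odd]
      rcases i with _ | i
      · rw [mul_zero, reflectCons_zero]; rfl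
      · have h := le_upperNum_of_mem hl (i := 2 * i) (by omega)
        rw [show 2 * (i + 1) = 2 * i + 2 by ring, reflectCons_even,
          show a + (2 * i + 2) + 1 = a + 1 + (2 * i + 2) by ring]
        omega
    · rw [show a + (2 * i + 1) = a + 1 + 2 * i by ring, ← le_upperNum_iff (by omega),
        reflectCons_odd, show 2 * i + 1 + 1 = 2 * i + 2 by ring, reflectCons_even]
      have h := lowerNum_le_of_mem hl (2 * i + 1)
      rw [show a + 1 + (2 * i + 1) + 1 = a + 1 + (2 * i + 2) by ring,
        show 2 * i + 1 + 1 = 2 * i + 2 by ring] at h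
      omega
  · obtain ⟨i, rfl | rfl⟩ := Nat.even_or_odd' i
    · obtain ⟨j, rfl⟩ : ∃ j, i = j + 1 := ⟨i - 1, by omega⟩
      rw [show 2 * (j + 1) = 2 * j + 2 by ring, reflectCons_even, hl.2 _ (by omega),
        hl.2 (2 * j + 2) (by omega), upperNum_zero, lowerNum_zero, Nat.zero_sub]
    · rw [reflectCons_odd, hl.2 _ (by omega)]
  · rw [reflectCons_zero]
    exact congrArg _ (reflectCons_odd a l 0).symm

theorem reflectTail_mem {a r : ℕ} {l : ℕ → ℕ} (hl : l ∈ ratioSeqs a (2 * r + 1)) :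
    reflectTail a l ∈ ratioSeqs (a + 1) (2 * r) := by
  refine ⟨fun i => ?_, fun i hi => ?_⟩
  · obtain ⟨i, rfl | rfl⟩ := Nat.even_or_odd' i
    · rw [← le_upperNum_iff (by omega), reflectTail_odd, reflectTail_even]
      have h := lowerNum_le_of_mem hl (2 * i + 2)
      rw [show a + (2 * i + 2) + 1 = a + 1 + (2 * i + 2) by ring,
        show 2 * i + 2 + 1 = 2 * i + 3 by ring] at h
      omega
    · have e : reflectTail a l (2 * i + 1 + 1) = l (2 * i + 3) := reflectTail_even a l (i + 1)
      rw [← lowerNum_le_iff, e, reflectTail_odd,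
        show a + 1 + (2 * i + 1) + 1 = a + 1 + (2 * i + 2) by ring]
      have h := le_upperNum_of_mem hl (i := 2 * i + 1) (by omega)
      rw [show a + (2 * i + 1) = a + 1 + 2 * i by ring,
        show 2 * i + 1 + 1 = 2 * i + 2 by ring] at h
      omega
  · obtain ⟨i, rfl | rfl⟩ := Nat.even_or_odd' i
    · rw [reflectTail_even, hl.2 _ (by omega)]
    · rw [reflectTail_odd, hl.2 _ (by omega), hl.2 (2 * i + 3) (by omega), upperNum_zero,
        lowerNum_zero, Nat.zero_sub]

theorem reflectTail_reflectCons {a k : ℕ} {l : ℕ → ℕ} (hl : l ∈ ratioSeqs (a + 1) k) :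
    reflectTail a (reflectCons a l) = l := by
  funext i
  obtain ⟨i, rfl | rfl⟩ := Nat.even_or_odd' i
  · rw [reflectTail_even, reflectCons_odd]
  · rw [reflectTail_odd, reflectCons_odd, show 2 * i + 3 = 2 * (i + 1) + 1 by ring,
      reflectCons_odd, reflectCons_even, show 2 * (i + 1) = 2 * i + 2 by ring]
    have h := le_upperNum_of_mem hl (i := 2 * i) (by omega)
    omega

theorem reflectCons_reflectTail {a k : ℕ} {l : ℕ → ℕ} (hl : l ∈ minSeqs a k) :
    reflectCons a (reflectTail a l) = l := by
  funext i
  obtain ⟨i, rfl | rfl⟩ := Nat.even_or_odd' i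
  · rcases i with _ | i
    · rw [mul_zero, reflectCons_zero, hl.2]
      exact congrArg _ (reflectTail_even a l 0)
    · rw [show 2 * (i + 1) = 2 * i + 2 by ring, reflectCons_even, reflectTail_even,
        reflectTail_odd, show 2 * i + 2 = 2 * (i + 1) by ring, reflectTail_even,
        show 2 * (i + 1) + 1 = 2 * i + 3 by ring, show 2 * (i + 1) = 2 * i + 2 by ring]
      have h := le_upperNum_of_mem hl.1 (i := 2 * i + 1) (by omega)
      rw [show a + (2 * i + 1) = a + 1 + 2 * i by ring,
        show 2 * i + 1 + 1 = 2 * i + 2 by ring] at h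
      omega
  · rw [reflectCons_odd, reflectTail_even]

/-- Prepending at denominator `a` shifts indices by one, so every old entry keeps its denominator.
Its even-indexed entries are unchanged; the odd-indexed ones are reflected in their intervals, an
involution. -/
theorem reflectCons_bijOn (a r : ℕ) :
    Set.BijOn (reflectCons a) (ratioSeqs (a + 1) (2 * r)) (minSeqs a (2 * r + 1)) :=
  Set.InvOn.bijOn (f' := reflectTail a)
    ⟨fun _ hl => reflectTail_reflectCons hl, fun _ hl => reflectCons_reflectTail hl⟩
    (fun _ hl => reflectCons_mem hl) (fun _ hl => reflectTail_mem hl.1)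

theorem mem_ratioSeqs_pred {a k : ℕ} {l : ℕ → ℕ} :
    l ∈ ratioSeqs a k ↔ l ∈ ratioSeqs a (k + 1) ∧ l k = 0 := by
  constructor
  · exact fun h => ⟨⟨h.1, fun i hi => h.2 i (by omega)⟩, h.2 k le_rfl⟩
  · rintro ⟨h, h0⟩
    refine ⟨h.1, fun i hi => ?_⟩
    rcases hi.eq_or_lt with rfl | hi
    · exact h0
    · exact h.2 i hi

theorem reflectCons_bijOn_maxSeqs (a r : ℕ) :
    Set.BijOn (reflectCons a) (maxSeqs (a + 1) (2 * r)) (minSeqs a (2 * r + 2)) := by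
  have h := reflectCons_bijOn a (r + 1)
  -- The entry after the last one is 0, so the final reflected entry is the upper bound minus `l (2
  -- * r + 1)`; it vanishes exactly when that entry is maximal.
  have key : ∀ l ∈ ratioSeqs (a + 1) (2 * r + 2),
      (reflectCons a l (2 * r + 2) = 0 ↔ l (2 * r + 1) = upperNum (a + 1 + 2 * r) (l (2 * r))) := by
    intro l hl
    have h1 := le_upperNum_of_mem hl (i := 2 * r) (by omega)
    rw [reflectCons_even, hl.2 (2 * r + 2) le_rfl, lowerNum_zero]
    omega
  refine ⟨fun l hl => ?_, h.injOn.mono fun l hl => hl.1, fun l hl => ?_⟩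
  · have h1 := h.mapsTo hl.1
    exact ⟨mem_ratioSeqs_pred.2 ⟨h1.1, (key l hl.1).2 hl.2⟩, h1.2⟩
  · obtain ⟨m, hm, rfl⟩ := h.surjOn ⟨(mem_ratioSeqs_pred.1 hl.1).1, hl.2⟩
    exact ⟨m, ⟨hm, (key m hm).1 (mem_ratioSeqs_pred.1 hl.1).2⟩, rfl⟩

theorem oddIndexSum_reflectCons (a R : ℕ) (l : ℕ → ℕ) :
    oddIndexSum R (reflectCons a l) = evenIndexSum R l :=
  Finset.sum_congr rfl fun i _ => reflectCons_odd a l i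

theorem evenIndexSum_reflectCons {a k R : ℕ} {l : ℕ → ℕ} (hl : l ∈ ratioSeqs (a + 1) k)
    (hk : k ≤ 2 * R) : evenIndexSum (R + 1) (reflectCons a l) + oddIndexSum (R + 1) l =
      2 * evenIndexSum (R + 1) l := by
  -- Telescoping: the lower endpoint left over at index 2s meets the upper endpoint of the next
  -- reflected entry, and they add up to 2 · `l (2 * s)`.
  have key : ∀ s, evenIndexSum (s + 1) (reflectCons a l) + oddIndexSum s l =
      2 * evenIndexSum s l + lowerNum (a + 1 + 2 * s) (l (2 * s)) := by
    intro s
    induction s with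
    | zero => simp [evenIndexSum, oddIndexSum, reflectCons_zero]
    | succ s ih =>
      rw [evenIndexSum, Finset.sum_range_succ, ← evenIndexSum, oddIndexSum, Finset.sum_range_succ,
        ← oddIndexSum, evenIndexSum.eq_def (s + 1) l, Finset.sum_range_succ, ← evenIndexSum,
        show 2 * (s + 1) = 2 * s + 2 by ring, reflectCons_even]
      have h1 := le_upperNum_of_mem hl (i := 2 * s) (by omega)
      have h2 := lowerNum_add_upperNum (a + 1 + 2 * s) (l (2 * s))
      omega
  have h := key R
  rw [hl.2 (2 * R) hk, lowerNum_zero] at h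
  rw [oddIndexSum, Finset.sum_range_succ, ← oddIndexSum, evenIndexSum.eq_def (R + 1) l,
    Finset.sum_range_succ, ← evenIndexSum, hl.2 _ hk, hl.2 _ (by omega)]
  omega

/-! ### Generating functions and substitutions on integer exponents. -/

/-- The generating function of `S` with respect to two statistics `o` and `e`. -/
noncomputable def statGF {ι : Type*} (S : Set ι) (o e : ι → ℕ) : MvPowerSeries (Fin 2) ℚ :=
  fun m => ({l | l ∈ S ∧ o l = m 0 ∧ e l = m 1}.ncard : ℚ)

/-- The coefficient of `x ^ p.1 * y ^ p.2`, which is zero if an exponent is negative. -/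
noncomputable def intCoeff (f : MvPowerSeries (Fin 2) ℚ) (p : ℤ × ℤ) : ℚ :=
  if 0 ≤ p.1 ∧ 0 ≤ p.2 then
    MvPowerSeries.coeff (Finsupp.single 0 p.1.toNat + Finsupp.single 1 p.2.toNat) f
  else 0

theorem finsupp_fin_two_eq (m : Fin 2 →₀ ℕ) :
    Finsupp.single 0 (m 0) + Finsupp.single 1 (m 1) = m := by
  ext i
  fin_cases i <;> simp

theorem eq_of_intCoeff_eq {f g : MvPowerSeries (Fin 2) ℚ} (h : ∀ p, intCoeff f p = intCoeff g p) :
    f = g := by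
  ext m
  have := h (m 0, m 1)
  simpa [intCoeff, finsupp_fin_two_eq] using this

theorem intCoeff_statGF {ι : Type*} (S : Set ι) (o e : ι → ℕ) (p : ℤ × ℤ) :
    intCoeff (statGF S o e) p = ({l | l ∈ S ∧ ((o l : ℤ), (e l : ℤ)) = p}.ncard : ℚ) := by
  obtain ⟨a, b⟩ := p
  simp only [intCoeff]
  split_ifs with h
  · obtain ⟨ha, hb⟩ := h
    lift a to ℕ using ha
    lift b to ℕ using hb
    simp [statGF, MvPowerSeries.coeff_apply]
  · have : {l | l ∈ S ∧ ((o l : ℤ), (e l : ℤ)) = (a, b)} = ∅ := by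
      ext l
      simp only [Prod.mk.injEq, Set.mem_ofPred_eq, Set.mem_empty_iff_false, iff_false]
      rintro ⟨-, rfl, rfl⟩
      simp at h
    rw [this, Set.ncard_empty, Nat.cast_zero]

theorem intCoeff_sub (f g : MvPowerSeries (Fin 2) ℚ) (p : ℤ × ℤ) :
    intCoeff (f - g) p = intCoeff f p - intCoeff g p := by
  simp only [intCoeff]
  split_ifs <;> simp

theorem xVar_pow_mul_yVar_pow (c d : ℕ) : xVar ^ c * yVar ^ d =
    MvPowerSeries.monomial (Finsupp.single 0 c + Finsupp.single 1 d) 1 := by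
  rw [xVar, yVar, MvPowerSeries.X_pow_eq, MvPowerSeries.X_pow_eq,
    MvPowerSeries.monomial_mul_monomial, one_mul]

theorem intCoeff_monomial_mul (c d : ℕ) (f : MvPowerSeries (Fin 2) ℚ) (p : ℤ × ℤ) :
    intCoeff (xVar ^ c * yVar ^ d * f) p = intCoeff f (p - ((c : ℤ), (d : ℤ))) := by
  obtain ⟨a, b⟩ := p
  rw [xVar_pow_mul_yVar_pow]
  simp only [intCoeff, Prod.mk_sub_mk, MvPowerSeries.coeff_monomial_mul, one_mul]
  by_cases h : 0 ≤ a ∧ 0 ≤ b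
  · obtain ⟨ha, hb⟩ := h
    lift a to ℕ using ha
    lift b to ℕ using hb
    have hle : (Finsupp.single (0 : Fin 2) c + Finsupp.single 1 d ≤
        Finsupp.single 0 a + Finsupp.single 1 b) ↔ c ≤ a ∧ d ≤ b := by
      simp [Finsupp.le_def, Fin.forall_fin_two]
    simp only [Int.toNat_natCast, hle, sub_nonneg, Nat.cast_le, Nat.cast_nonneg, and_self, if_true]
    refine if_congr Iff.rfl ?_ rfl
    refine congrArg (fun m => MvPowerSeries.coeff m f) ?_
    ext i
    fin_cases i <;> simp
  · rw [if_neg h, if_neg]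
    omega

/-- `f` arises from `g` by the monomial substitution that maps the exponent `p` to `T p`. -/
def IsTransform (T : ℤ × ℤ ≃+ ℤ × ℤ) (f g : MvPowerSeries (Fin 2) ℚ) : Prop :=
  ∀ p, intCoeff f (T p) = intCoeff g p

namespace IsTransform

variable {T : ℤ × ℤ ≃+ ℤ × ℤ} {f f' g g' : MvPowerSeries (Fin 2) ℚ}

theorem right_unique (h : IsTransform T f g) (h' : IsTransform T f g') : g = g' :=
  eq_of_intCoeff_eq fun p => (h p).symm.trans (h' p)

/-- The substitution involves x⁻¹ and is not an endomorphism of power series, so it is treated as a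
relation. Surjectivity of `T` makes the image unique; the preimage is unique without it. -/
theorem left_unique (h : IsTransform T f g) (h' : IsTransform T f' g) : f = f' :=
  eq_of_intCoeff_eq fun p => by
    have := (h (T.symm p)).trans (h' (T.symm p)).symm
    simpa using this

theorem one : IsTransform T 1 1 := by
  have key : ∀ p : ℤ × ℤ, intCoeff 1 p = if p = 0 then 1 else 0 := by
    rintro ⟨a, b⟩
    simp only [intCoeff, MvPowerSeries.coeff_one]
    by_cases h : 0 ≤ a ∧ 0 ≤ b
    · obtain ⟨ha, hb⟩ := h
      lift a to ℕ using ha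
      lift b to ℕ using hb
      simp [Finsupp.ext_iff, Fin.forall_fin_two]
    · rw [if_neg h, if_neg]
      rintro ⟨⟩
      simp at h
  intro p
  rw [key, key]
  simp

/-- Multiplication by a monomial translates exponents, and the additive map `T` carries translations
to translations. -/
theorem one_sub_monomial_mul (h : IsTransform T f g) {c d c' d' : ℕ}
    (hT : T ((c : ℤ), (d : ℤ)) = ((c' : ℤ), (d' : ℤ))) :
    IsTransform T ((1 - xVar ^ c' * yVar ^ d') * f) ((1 - xVar ^ c * yVar ^ d) * g) := by
  intro p
  rw [sub_mul, sub_mul, one_mul, one_mul, intCoeff_sub, intCoeff_sub, intCoeff_monomial_mul,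
    intCoeff_monomial_mul, h p, ← hT, ← map_sub, h]

theorem qPoch_mul (h : IsTransform T f g) (hT1 : T (1, 1) = (1, 1)) {c d c' d' : ℕ}
    (hT : T ((c : ℤ), (d : ℤ)) = ((c' : ℤ), (d' : ℤ))) (m : ℕ) :
    IsTransform T (qPoch (xVar ^ c' * yVar ^ d') (xVar * yVar) m * f)
      (qPoch (xVar ^ c * yVar ^ d) (xVar * yVar) m * g) := by
  induction m with
  | zero => simpa [qPoch] using h
  | succ m ih =>
    have hT' : T (((c + m : ℕ) : ℤ), ((d + m : ℕ) : ℤ)) =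
        (((c' + m : ℕ) : ℤ), ((d' + m : ℕ) : ℤ)) := by
      have e : (((c + m : ℕ) : ℤ), ((d + m : ℕ) : ℤ)) = ((c : ℤ), (d : ℤ)) + m • ((1 : ℤ), (1 : ℤ)) := by
        simp
      rw [e, map_add, map_nsmul, hT1, hT]
      simp
    have e : ∀ (c d : ℕ) (f : MvPowerSeries (Fin 2) ℚ),
        qPoch (xVar ^ c * yVar ^ d) (xVar * yVar) (m + 1) * f =
        (1 - xVar ^ (c + m) * yVar ^ (d + m)) *
          (qPoch (xVar ^ c * yVar ^ d) (xVar * yVar) m * f) := by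
      intro c d f
      rw [qPoch, Finset.prod_range_succ, ← qPoch]
      ring
    rw [e, e]
    exact ih.one_sub_monomial_mul hT'

theorem qPoch_prod_pow_mul (h : IsTransform T f g) (hT1 : T (1, 1) = (1, 1)) (c m : ℕ) :
    IsTransform T (qPoch ((xVar * yVar) ^ c) (xVar * yVar) m * f)
      (qPoch ((xVar * yVar) ^ c) (xVar * yVar) m * g) := by
  simp only [mul_pow]
  refine h.qPoch_mul hT1 ?_ m
  have e : ((c : ℤ), (c : ℤ)) = c • ((1 : ℤ), (1 : ℤ)) := by simp
  rw [e, map_nsmul, hT1]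

end IsTransform

theorem isTransform_statGF {ι κ : Type*} {T : ℤ × ℤ ≃+ ℤ × ℤ} {S : Set ι} {S' : Set κ}
    {o e : ι → ℕ} {o' e' : κ → ℕ} {φ : ι → κ} (hφ : Set.BijOn φ S S')
    (hT : ∀ l ∈ S, T ((o l : ℤ), (e l : ℤ)) = ((o' (φ l) : ℤ), (e' (φ l) : ℤ))) :
    IsTransform T (statGF S' o' e') (statGF S o e) := by
  intro p
  rw [intCoeff_statGF, intCoeff_statGF]
  congr 1
  symm
  refine Set.ncard_congr (fun l _ => φ l) ?_ ?_ ?_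
  · rintro l ⟨hl, rfl⟩
    exact ⟨hφ.mapsTo hl, (hT l hl).symm⟩
  · rintro l m ⟨hl, -⟩ ⟨hm, -⟩ h
    exact hφ.injOn hl hm h
  · rintro m ⟨hm, hp⟩
    obtain ⟨l, hl, rfl⟩ := hφ.surjOn hm
    exact ⟨l, ⟨hl, T.injective ((hT l hl).trans hp)⟩, rfl⟩

theorem statGF_eq_of_bijOn {ι κ : Type*} {S : Set ι} {S' : Set κ}
    {o e : ι → ℕ} {o' e' : κ → ℕ} {φ : ι → κ} (hφ : Set.BijOn φ S S')
    (ho : ∀ l ∈ S, o' (φ l) = o l) (he : ∀ l ∈ S, e' (φ l) = e l) :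
    statGF S' o' e' = statGF S o e := by
  have h := isTransform_statGF (T := AddEquiv.refl _) (o := o) (e := e) (o' := o') (e' := e') hφ
    fun l hl => by simp [ho l hl, he l hl]
  exact eq_of_intCoeff_eq h

theorem statGF_shift {ι : Type*} {S S' : Set ι} {o e : ι → ℕ} {φ : ι → ι}
    (hφ : Set.BijOn φ S S') (c d : ℕ) (ho : ∀ l ∈ S, o (φ l) = o l + c)
    (he : ∀ l ∈ S, e (φ l) = e l + d) :
    statGF S' o e = xVar ^ c * yVar ^ d * statGF S o e := by
  refine eq_of_intCoeff_eq fun p => ?_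
  rw [intCoeff_monomial_mul, intCoeff_statGF, intCoeff_statGF]
  congr 1
  symm
  have hT : ∀ l ∈ S, (((o l : ℤ), (e l : ℤ)) = p - ((c : ℤ), (d : ℤ)) ↔
      ((o (φ l) : ℤ), (e (φ l) : ℤ)) = p) := by
    intro l hl
    rw [eq_sub_iff_add_eq, ho l hl, he l hl]
    simp
  refine Set.ncard_congr (fun l _ => φ l) ?_ ?_ ?_
  · rintro l ⟨hl, h⟩
    exact ⟨hφ.mapsTo hl, (hT l hl).1 h⟩
  · rintro l m ⟨hl, -⟩ ⟨hm, -⟩ h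
    exact hφ.injOn hl hm h
  · rintro m ⟨hm, hp⟩
    obtain ⟨l, hl, rfl⟩ := hφ.surjOn hm
    exact ⟨l, ⟨hl, (hT l hl).2 hp⟩, rfl⟩

theorem statGF_union {ι : Type*} {S S' : Set ι} {o e : ι → ℕ} (hd : Disjoint S S')
    (hf : ∀ a b, {l | l ∈ S ∪ S' ∧ o l = a ∧ e l = b}.Finite) :
    statGF (S ∪ S') o e = statGF S o e + statGF S' o e := by
  ext m
  simp only [statGF, MvPowerSeries.coeff_apply, map_add]
  rw [← Nat.cast_add, ← Set.ncard_union_eq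
    (Set.disjoint_left.2 fun l h h' => Set.disjoint_left.1 hd h.1 h'.1)
    ((hf _ _).subset fun l h => ⟨Or.inl h.1, h.2⟩)
    ((hf _ _).subset fun l h => ⟨Or.inr h.1, h.2⟩)]
  congr 2
  ext l
  simp only [Set.mem_union, Set.mem_ofPred_eq]
  tauto

/-- Finiteness is what makes `Set.ncard` additive when a set of sequences is split; `k ≤ 2 * R`
ensures that the sums see every entry. -/
theorem finite_ratioSeqs_weights {a k R : ℕ} (hk : k ≤ 2 * R) (p s : ℕ) :
    {l | l ∈ ratioSeqs a k ∧ evenIndexSum R l = p ∧ oddIndexSum R l = s}.Finite := by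
  refine Set.Finite.of_injOn (f := fun l (i : Fin k) => l i) (t := Set.Iic fun _ => p + s)
    ?_ ?_ (Set.finite_Iic _)
  · rintro l ⟨-, rfl, rfl⟩ ⟨i, hi⟩
    change l i ≤ _
    obtain ⟨i, rfl | rfl⟩ := Nat.even_or_odd' i
    · have := Finset.single_le_sum (f := fun i => l (2 * i)) (fun _ _ => Nat.zero_le _)
        (Finset.mem_range.2 (show i < R by omega))
      exact this.trans (Nat.le_add_right _ _)
    · have := Finset.single_le_sum (f := fun i => l (2 * i + 1)) (fun _ _ => Nat.zero_le _)
        (Finset.mem_range.2 (show i < R by omega))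
      exact this.trans (Nat.le_add_left _ _)
  · rintro l ⟨hl, -⟩ m ⟨hm, -⟩ h
    funext i
    by_cases hi : i < k
    · exact congrFun h ⟨i, hi⟩
    · rw [hl.2 i (not_lt.1 hi), hm.2 i (not_lt.1 hi)]

/-! ### Recurrences from raising the first or the last entry. -/

/-- The generating function of a set of sequences by the sums of the entries of even and of odd
index. -/
noncomputable def seqGF (R : ℕ) (S : Set (ℕ → ℕ)) : MvPowerSeries (Fin 2) ℚ :=
  statGF S (evenIndexSum R) (oddIndexSum R)

theorem seqGF_union {a k R : ℕ} (hk : k ≤ 2 * R) {S S' : Set (ℕ → ℕ)} (hd : Disjoint S S')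
    (h : S ∪ S' = ratioSeqs a k) : seqGF R (ratioSeqs a k) = seqGF R S + seqGF R S' := by
  rw [← h]
  refine statGF_union hd fun p s => ?_
  rw [h]
  exact finite_ratioSeqs_weights hk p s

/-- Increase the entry of index `j` by one. -/
def incAt (j : ℕ) (l : ℕ → ℕ) (i : ℕ) : ℕ := l i + if i = j then 1 else 0

theorem incAt_self (j : ℕ) (l : ℕ → ℕ) : incAt j l j = l j + 1 := by simp [incAt]

theorem incAt_of_ne {i j : ℕ} (l : ℕ → ℕ) (h : i ≠ j) : incAt j l i = l i := by simp [incAt, h]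

theorem incAt_injective (j : ℕ) : Function.Injective (incAt j) := by
  intro l m h
  funext i
  exact Nat.add_right_cancel (congrFun h i)

theorem exists_incAt_eq {j : ℕ} {l : ℕ → ℕ} (h : l j ≠ 0) : ∃ m, incAt j m = l := by
  refine ⟨fun i => l i - if i = j then 1 else 0, ?_⟩
  funext i
  by_cases hi : i = j
  · subst hi
    simp only [incAt, if_true]
    omega
  · simp [incAt, hi]

theorem evenIndexSum_incAt_even {r R : ℕ} (h : r < R) (l : ℕ → ℕ) :
    evenIndexSum R (incAt (2 * r) l) = evenIndexSum R l + 1 := by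
  simp [evenIndexSum, incAt, Finset.sum_add_distrib, h]

theorem oddIndexSum_incAt_even (r R : ℕ) (l : ℕ → ℕ) :
    oddIndexSum R (incAt (2 * r) l) = oddIndexSum R l :=
  Finset.sum_congr rfl fun i _ => incAt_of_ne l (by omega)

theorem evenIndexSum_incAt_odd (r R : ℕ) (l : ℕ → ℕ) :
    evenIndexSum R (incAt (2 * r + 1) l) = evenIndexSum R l :=
  Finset.sum_congr rfl fun i _ => incAt_of_ne l (by omega)

theorem oddIndexSum_incAt_odd {r R : ℕ} (h : r < R) (l : ℕ → ℕ) :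
    oddIndexSum R (incAt (2 * r + 1) l) = oddIndexSum R l + 1 := by
  simp [oddIndexSum, incAt, Finset.sum_add_distrib, h]

/-- The first entry is bounded only from below, so sequences where it is not minimal are exactly the
sequences with it raised by one. -/
theorem one_sub_xVar_mul_seqGF {a k R : ℕ} (hk : k + 1 ≤ 2 * R) :
    (1 - xVar) * seqGF R (ratioSeqs a (k + 1)) = seqGF R (minSeqs a (k + 1)) := by
  set S' : Set (ℕ → ℕ) := {l | l ∈ ratioSeqs a (k + 1) ∧ l 0 ≠ lowerNum (a + 1) (l 1)}
  have hu : seqGF R (ratioSeqs a (k + 1)) = seqGF R (minSeqs a (k + 1)) + seqGF R S' := by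
    refine seqGF_union hk (Set.disjoint_left.2 fun l h h' => h'.2 h.2) ?_
    ext l
    simp only [S', minSeqs, Set.mem_union, Set.mem_ofPred_eq]
    tauto
  have hb : Set.BijOn (incAt 0) (ratioSeqs a (k + 1)) S' := by
    refine ⟨fun l hl => ⟨⟨fun i => ?_, fun i hi => ?_⟩, ?_⟩, (incAt_injective 0).injOn,
      fun l hl => ?_⟩
    · rw [incAt_of_ne l (by omega : i + 1 ≠ 0)]
      exact (hl.1 i).trans (Nat.mul_le_mul_right _ (Nat.le_add_right _ _))
    · rw [incAt_of_ne l (by omega), hl.2 i hi]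
    · rw [incAt_self, incAt_of_ne l one_ne_zero]
      have : lowerNum (a + 1) (l 1) ≤ l 0 := lowerNum_le_of_mem hl 0
      omega
    · have h : lowerNum (a + 1) (l 1) ≤ l 0 := lowerNum_le_of_mem hl.1 0
      have hne := hl.2
      obtain ⟨m, rfl⟩ := exists_incAt_eq (j := 0) (l := l) (by omega)
      refine ⟨m, ⟨fun i => ?_, fun i hi => ?_⟩, rfl⟩
      · have hi := hl.1.1 i
        rw [incAt_of_ne m (by omega : i + 1 ≠ 0)] at hi
        rcases i with _ | i
        · rw [incAt_self, incAt_of_ne m one_ne_zero] at h hne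
          exact (lowerNum_le_iff _ _ _).1 (by simpa using (by omega : lowerNum (a + 1) (m 1) ≤ m 0))
        · rwa [incAt_of_ne m (by omega)] at hi
      · have := hl.1.2 i hi
        rwa [incAt_of_ne m (by omega)] at this
  have hs : seqGF R S' = xVar * seqGF R (ratioSeqs a (k + 1)) := by
    have := statGF_shift (o := evenIndexSum R) (e := oddIndexSum R) hb 1 0
      (fun l _ => evenIndexSum_incAt_even (r := 0) (by omega) l)
      (fun l _ => oddIndexSum_incAt_even 0 R l)
    simpa [seqGF] using this
  rw [hs] at hu
  linear_combination hu

/-- Raising the last entry maps the sequences where it is not maximal onto those where it is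
nonzero; those where it is zero have one entry fewer. -/
theorem one_sub_yVar_mul_seqGF {a r R : ℕ} (ha : 0 < a) (hr : r < R) :
    (1 - yVar) * seqGF R (ratioSeqs a (2 * r + 2)) =
      seqGF R (ratioSeqs a (2 * r + 1)) - yVar * seqGF R (maxSeqs a (2 * r)) := by
  set S : Set (ℕ → ℕ) :=
    {l | l ∈ ratioSeqs a (2 * r + 2) ∧ l (2 * r + 1) ≠ upperNum (a + 2 * r) (l (2 * r))}
  set S' : Set (ℕ → ℕ) := {l | l ∈ ratioSeqs a (2 * r + 2) ∧ l (2 * r + 1) ≠ 0}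
  have hu : seqGF R (ratioSeqs a (2 * r + 2)) = seqGF R (maxSeqs a (2 * r)) + seqGF R S := by
    refine seqGF_union (by omega) (Set.disjoint_left.2 fun l h h' => h'.2 h.2) ?_
    ext l
    simp only [S, maxSeqs, Set.mem_union, Set.mem_ofPred_eq]
    tauto
  have hu' : seqGF R (ratioSeqs a (2 * r + 2)) =
      seqGF R (ratioSeqs a (2 * r + 1)) + seqGF R S' := by
    refine seqGF_union (by omega)
      (Set.disjoint_left.2 fun l h h' => h'.2 (mem_ratioSeqs_pred.1 h).2) ?_
    ext l
    simp only [S', Set.mem_union, Set.mem_ofPred_eq, mem_ratioSeqs_pred (k := 2 * r + 1)]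
    tauto
  have hle : ∀ l : ℕ → ℕ, l (2 * r + 1) ≤ upperNum (a + 2 * r) (l (2 * r)) ↔
      l (2 * r + 1) * (a + 2 * r) ≤ l (2 * r) * (a + 2 * r + 1) :=
    fun l => le_upperNum_iff (by omega) _ _
  have hb : Set.BijOn (incAt (2 * r + 1)) S S' := by
    refine ⟨fun l hl => ⟨⟨fun i => ?_, fun i hi => ?_⟩, ?_⟩, (incAt_injective _).injOn,
      fun l hl => ?_⟩
    · by_cases hi : i = 2 * r
      · subst hi
        have h := (hle l).2 (hl.1.1 _)
        have hne := hl.2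
        rw [← hle, incAt_self, incAt_of_ne l (by omega)]
        omega
      · rw [incAt_of_ne l (by omega)]
        exact (hl.1.1 i).trans (Nat.mul_le_mul_right _ (Nat.le_add_right _ _))
    · rw [incAt_of_ne l (by omega), hl.1.2 i hi]
    · rw [incAt_self]
      omega
    · obtain ⟨m, rfl⟩ := exists_incAt_eq hl.2
      have h := (hle _).2 (hl.1.1 (2 * r))
      rw [incAt_self, incAt_of_ne m (by omega)] at h
      refine ⟨m, ⟨⟨fun i => ?_, fun i hi => ?_⟩, by omega⟩, rfl⟩
      · by_cases hi : i = 2 * r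
        · subst hi
          rw [← hle]
          omega
        · by_cases hi' : i = 2 * r + 1
          · subst hi'
            have := hl.1.2 (2 * r + 1 + 1) le_rfl
            rw [incAt_of_ne m (by omega)] at this
            rw [this, zero_mul]
            exact Nat.zero_le _
          · have := hl.1.1 i
            rwa [incAt_of_ne m (by omega), incAt_of_ne m hi'] at this
      · have := hl.1.2 i hi
        rwa [incAt_of_ne m (by omega)] at this
  have hs : seqGF R S' = yVar * seqGF R S := by
    have := statGF_shift (o := evenIndexSum R) (e := oddIndexSum R) hb 0 1
      (fun l _ => evenIndexSum_incAt_odd r R l)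
      (fun l _ => oddIndexSum_incAt_odd hr l)
    simpa [seqGF] using this
  rw [hs] at hu'
  linear_combination hu' - yVar * hu

/-! ### The substitutions attached to reflection and to deletion of a zero. -/

/-- The exponent map of the substitution `x ↦ x ^ 2 * y`, `y ↦ x⁻¹`. -/
def reflectExp : ℤ × ℤ ≃+ ℤ × ℤ where
  toFun p := (2 * p.1 - p.2, p.1)
  invFun p := (p.2, 2 * p.2 - p.1)
  left_inv p := by simp
  right_inv p := by simp
  map_add' p p' := by
    ext
    · simp only [Prod.fst_add, Prod.snd_add]
      ring
    · simp

theorem reflectExp_apply (p q : ℤ) : reflectExp (p, q) = (2 * p - q, p) := rfl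

theorem isTransform_reflect {a k R : ℕ} {S S' : Set (ℕ → ℕ)} (hk : k ≤ 2 * R)
    (hS : S ⊆ ratioSeqs (a + 1) k) (hb : Set.BijOn (reflectCons a) S S') :
    IsTransform reflectExp (seqGF (R + 1) S') (seqGF (R + 1) S) := by
  refine isTransform_statGF hb fun l hl => ?_
  have h := evenIndexSum_reflectCons (hS hl) hk
  rw [oddIndexSum_reflectCons, reflectExp_apply, Prod.mk.injEq]
  exact ⟨by omega, rfl⟩

/-- The exponent map of the substitution that exchanges `x` and `y`. -/
def swapExp : ℤ × ℤ ≃+ ℤ × ℤ := AddEquiv.prodComm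

/-- For `a = 0` the minimal first entry is 0 and constrains nothing after it; removing it exchanges
the parities of the indices. -/
theorem isTransform_tail {k R : ℕ} (hk : k ≤ 2 * R) :
    IsTransform swapExp (seqGF (R + 1) (minSeqs 0 (k + 1))) (seqGF (R + 1) (ratioSeqs 1 k)) := by
  have hb : Set.BijOn (fun (l : ℕ → ℕ) (i : ℕ) => if i = 0 then 0 else l (i - 1)) (ratioSeqs 1 k)
      (minSeqs 0 (k + 1)) := by
    refine Set.InvOn.bijOn (f' := fun l i => l (i + 1)) ⟨fun l hl => ?_, fun l hl => ?_⟩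
      (fun l hl => ⟨⟨fun i => ?_, fun i hi => ?_⟩, ?_⟩) (fun l hl => ⟨fun i => ?_, fun i hi => ?_⟩)
    · funext i
      simp
    · funext i
      rcases i with _ | i
      · simp [hl.2, lowerNum]
      · simp
    · rcases i with _ | i
      · simp
      · have := hl.1 i
        simpa [add_comm, add_left_comm] using this
    · simpa [show i ≠ 0 by omega] using hl.2 (i - 1) (by omega)
    · simp [lowerNum]
    · have := hl.1.1 (i + 1)
      simpa [add_comm, add_left_comm] using this
    · exact hl.1.2 (i + 1) (by omega)
  refine isTransform_statGF hb fun l hl => ?_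
  have h1 : evenIndexSum (R + 1) (fun i => if i = 0 then 0 else l (i - 1)) =
      oddIndexSum (R + 1) l := by
    rw [evenIndexSum, Finset.sum_range_succ', oddIndexSum, Finset.sum_range_succ,
      hl.2 (2 * R + 1) (by omega)]
    simp [show ∀ i, 2 * (i + 1) - 1 = 2 * i + 1 from fun i => by omega]
  have h2 : oddIndexSum (R + 1) (fun i => if i = 0 then 0 else l (i - 1)) =
      evenIndexSum (R + 1) l := by
    simp [evenIndexSum, oddIndexSum]
  rw [h1, h2]
  rfl

/-! ### Product formulas for both parities of the length. -/

theorem qPoch_succ {A : Type*} [CommRing A] (a q : A) (m : ℕ) :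
    qPoch a q (m + 1) = qPoch a q m * (1 - a * q ^ m) :=
  Finset.prod_range_succ _ _

theorem qPoch_succ' {A : Type*} [CommRing A] (a q : A) (m : ℕ) :
    qPoch a q (m + 1) = (1 - a) * qPoch (a * q) q m := by
  rw [qPoch, Finset.prod_range_succ', mul_comm, pow_zero, mul_one, qPoch]
  exact congrArg _ (Finset.prod_congr rfl fun i _ => by ring)

theorem constantCoeff_qPoch {a q : MvPowerSeries (Fin 2) ℚ} (ha : MvPowerSeries.constantCoeff a = 0)
    (m : ℕ) : MvPowerSeries.constantCoeff (qPoch a q m) = 1 := by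
  rw [qPoch, map_prod]
  exact Finset.prod_eq_one fun i _ => by simp [ha]

theorem constantCoeff_xVar : MvPowerSeries.constantCoeff xVar = 0 :=
  MvPowerSeries.constantCoeff_X 0

theorem constantCoeff_yVar : MvPowerSeries.constantCoeff yVar = 0 :=
  MvPowerSeries.constantCoeff_X 1

theorem one_sub_ne_zero_of_constantCoeff {a : MvPowerSeries (Fin 2) ℚ}
    (ha : MvPowerSeries.constantCoeff a = 0) : 1 - a ≠ 0 := by
  intro h
  have := congrArg MvPowerSeries.constantCoeff h
  simp [ha] at this

/-- Reflection sends (x;q)_r to (xq;q)_r; the factor 1 - x from the first entry completes it to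
(x;q)_(r+1). -/
theorem seqGF_odd_of_even {R r a : ℕ} (hr : r ≤ R)
    (h : seqGF (R + 1) (ratioSeqs (a + 1) (2 * r)) * (qPoch (xVar * yVar) (xVar * yVar) r *
      qPoch xVar (xVar * yVar) r * qPoch (xVar ^ (a + 1) * yVar ^ (a + 2)) (xVar * yVar) r) =
        qPoch ((xVar * yVar) ^ (a + 1 + r)) (xVar * yVar) r) :
    seqGF (R + 1) (ratioSeqs a (2 * r + 1)) * (qPoch (xVar * yVar) (xVar * yVar) r *
      qPoch xVar (xVar * yVar) (r + 1) * qPoch (xVar ^ a * yVar ^ (a + 1)) (xVar * yVar) r) =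
        qPoch ((xVar * yVar) ^ (a + r + 1)) (xVar * yVar) r := by
  have hT1 : reflectExp (1, 1) = (1, 1) := rfl
  have t := isTransform_reflect (by omega) subset_rfl (reflectCons_bijOn a r) (R := R)
  have t1 := (((t.qPoch_mul hT1 (c := a + 1) (d := a + 2) (c' := a) (d' := a + 1)
    (by rw [reflectExp_apply]; push_cast; ext <;> simp; ring) r).qPoch_mul hT1
    (c := 1) (d := 0) (c' := 2) (d' := 1) rfl r).qPoch_prod_pow_mul hT1 1 r)
  have t2 := (IsTransform.one (T := reflectExp)).qPoch_prod_pow_mul hT1 (a + 1 + r) r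
  have e : ∀ f, qPoch ((xVar * yVar) ^ 1) (xVar * yVar) r * (qPoch (xVar ^ 1 * yVar ^ 0)
      (xVar * yVar) r * (qPoch (xVar ^ (a + 1) * yVar ^ (a + 2)) (xVar * yVar) r * f)) =
      f * (qPoch (xVar * yVar) (xVar * yVar) r * qPoch xVar (xVar * yVar) r *
        qPoch (xVar ^ (a + 1) * yVar ^ (a + 2)) (xVar * yVar) r) := by
    intro f
    rw [pow_one, pow_one, pow_zero, mul_one]
    ring
  rw [e, h] at t1
  rw [mul_one] at t2
  have key := t1.left_unique t2
  rw [← one_sub_xVar_mul_seqGF (by omega), pow_one, pow_one,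
    show xVar ^ 2 * yVar = xVar * (xVar * yVar) by ring] at key
  rw [qPoch_succ', add_right_comm, ← key]
  ring

/-- The swap sends (x;q)_(r+1) to (y;q)_(r+1) and (xy²;q)_r to (xq;q)_r. The extra factor 1 -
q^(r+1) appears on both sides. -/
theorem seqGF_zero_even_of_odd {R r : ℕ} (hr : r < R)
    (h : seqGF (R + 1) (ratioSeqs 1 (2 * r + 1)) * (qPoch (xVar * yVar) (xVar * yVar) r *
      qPoch xVar (xVar * yVar) (r + 1) * qPoch (xVar ^ 1 * yVar ^ 2) (xVar * yVar) r) =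
        qPoch ((xVar * yVar) ^ (1 + r + 1)) (xVar * yVar) r) :
    seqGF (R + 1) (ratioSeqs 0 (2 * r + 2)) * (qPoch (xVar * yVar) (xVar * yVar) (r + 1) *
      qPoch xVar (xVar * yVar) (r + 1) * qPoch (xVar ^ 0 * yVar ^ 1) (xVar * yVar) (r + 1)) =
        qPoch ((xVar * yVar) ^ (0 + (r + 1))) (xVar * yVar) (r + 1) := by
  have hT1 : swapExp (1, 1) = (1, 1) := rfl
  have t := isTransform_tail (k := 2 * r + 1) (R := R) (by omega)
  have t1 := (((t.qPoch_mul hT1 (c := 1) (d := 2) (c' := 2) (d' := 1) rfl r).qPoch_mul hT1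
    (c := 1) (d := 0) (c' := 0) (d' := 1) rfl (r + 1)).qPoch_prod_pow_mul hT1 1 r)
  have t2 := (IsTransform.one (T := swapExp)).qPoch_prod_pow_mul hT1 (1 + r + 1) r
  have e : ∀ f, qPoch ((xVar * yVar) ^ 1) (xVar * yVar) r * (qPoch (xVar ^ 1 * yVar ^ 0)
      (xVar * yVar) (r + 1) * (qPoch (xVar ^ 1 * yVar ^ 2) (xVar * yVar) r * f)) =
      f * (qPoch (xVar * yVar) (xVar * yVar) r * qPoch xVar (xVar * yVar) (r + 1) *
        qPoch (xVar ^ 1 * yVar ^ 2) (xVar * yVar) r) := by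
    intro f
    rw [pow_one, pow_one, pow_zero, mul_one]
    ring
  rw [e, h] at t1
  rw [mul_one] at t2
  have key := t1.left_unique t2
  rw [← one_sub_xVar_mul_seqGF (by omega), pow_one, pow_one,
    show xVar ^ 2 * yVar = xVar * (xVar * yVar) by ring] at key
  rw [qPoch_succ' xVar, qPoch_succ (xVar * yVar) _ r, qPoch_succ' (_ ^ (0 + (r + 1))), zero_add,
    ← pow_succ, show r + 1 + 1 = 1 + r + 1 by ring, ← key, pow_one]
  ring

theorem seqGF_succ_even {R r a : ℕ} (hr : r < R)
    (ho : seqGF (R + 1) (ratioSeqs (a + 1) (2 * r + 1)) * (qPoch (xVar * yVar) (xVar * yVar) r *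
      qPoch xVar (xVar * yVar) (r + 1) *
        qPoch (xVar ^ (a + 1) * yVar ^ (a + 2)) (xVar * yVar) r) =
          qPoch ((xVar * yVar) ^ (a + 1 + r + 1)) (xVar * yVar) r)
    (he : seqGF (R + 1) (ratioSeqs a (2 * r + 2)) * (qPoch (xVar * yVar) (xVar * yVar) (r + 1) *
      qPoch xVar (xVar * yVar) (r + 1) *
        qPoch (xVar ^ a * yVar ^ (a + 1)) (xVar * yVar) (r + 1)) =
          qPoch ((xVar * yVar) ^ (a + (r + 1))) (xVar * yVar) (r + 1)) :
    seqGF (R + 1) (ratioSeqs (a + 1) (2 * r + 2)) *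
      (qPoch (xVar * yVar) (xVar * yVar) (r + 1) * qPoch xVar (xVar * yVar) (r + 1) *
        qPoch (xVar ^ (a + 1) * yVar ^ (a + 2)) (xVar * yVar) (r + 1)) =
          qPoch ((xVar * yVar) ^ (a + 1 + (r + 1))) (xVar * yVar) (r + 1) := by
  have hT1 : reflectExp (1, 1) = (1, 1) := rfl
  have t := isTransform_reflect (R := R) (by omega) (fun l hl => hl.1)
    (reflectCons_bijOn_maxSeqs a r)
  have t1 := (((t.qPoch_mul hT1 (c := a + 1) (d := a + 2) (c' := a) (d' := a + 1)
    (by rw [reflectExp_apply]; push_cast; ext <;> simp; ring) (r + 1)).qPoch_mul hT1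
    (c := 1) (d := 0) (c' := 2) (d' := 1) rfl r).qPoch_prod_pow_mul hT1 1 (r + 1))
  have t2 := (IsTransform.one (T := reflectExp)).qPoch_prod_pow_mul hT1 (a + (r + 1)) (r + 1)
  have e : ∀ f, qPoch ((xVar * yVar) ^ 1) (xVar * yVar) (r + 1) * (qPoch (xVar ^ 2 * yVar ^ 1)
      (xVar * yVar) r * (qPoch (xVar ^ a * yVar ^ (a + 1)) (xVar * yVar) (r + 1) *
        ((1 - xVar) * f))) =
      f * (qPoch (xVar * yVar) (xVar * yVar) (r + 1) * qPoch xVar (xVar * yVar) (r + 1) *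
        qPoch (xVar ^ a * yVar ^ (a + 1)) (xVar * yVar) (r + 1)) := by
    intro f
    rw [qPoch_succ' xVar, pow_one, pow_one, show xVar ^ 2 * yVar = xVar * (xVar * yVar) by ring]
    ring
  rw [← one_sub_xVar_mul_seqGF (by omega), e, he] at t1
  rw [mul_one] at t2
  -- Here the image under reflection is known from `he`, and the preimage, the series of `maxSeqs`,
  -- is deduced.
  have hmax := t1.right_unique t2
  have hsplit := one_sub_yVar_mul_seqGF (a := a + 1) (r := r) (R := R + 1) (by omega) (by omega)
  rw [pow_one, pow_one, pow_zero, mul_one, show a + (r + 1) = a + 1 + r by ring,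
    qPoch_succ' (_ ^ (a + 1 + r)), ← pow_succ] at hmax
  rw [show a + 1 + (r + 1) = a + 1 + r + 1 by ring, qPoch_succ (_ ^ (a + 1 + r + 1))]
  refine mul_left_cancel₀ (one_sub_ne_zero_of_constantCoeff constantCoeff_yVar) ?_
  rw [← mul_assoc, hsplit, sub_mul]
  have h1 : ∀ F G : MvPowerSeries (Fin 2) ℚ,
      F * (qPoch (xVar * yVar) (xVar * yVar) (r + 1) * qPoch xVar (xVar * yVar) (r + 1) * G) =
      F * (qPoch (xVar * yVar) (xVar * yVar) r * qPoch xVar (xVar * yVar) (r + 1) * G) *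
        (1 - xVar * yVar * (xVar * yVar) ^ r) := by
    intro F G
    rw [qPoch_succ (xVar * yVar)]
    ring
  rw [qPoch_succ xVar]
  rw [qPoch_succ (xVar * yVar), qPoch_succ (xVar ^ (a + 1) * _)] at hmax ⊢
  rw [qPoch_succ xVar] at ho
  -- With Q = q^r and A = q^(a+1), this is (1-qQ)(1-AyQ) - y(1-xQ)(1-AQ) = (1-y)(1-AqQ²).
  linear_combination (1 - xVar * yVar * (xVar * yVar) ^ r) *
    (1 - xVar ^ (a + 1) * yVar ^ (a + 2) * (xVar * yVar) ^ r) * ho -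
    yVar * (1 - xVar * (xVar * yVar) ^ r) * hmax

theorem ratioSeqs_zero (a : ℕ) : ratioSeqs a 0 = {0} := by
  ext l
  simp only [Set.mem_singleton_iff]
  refine ⟨fun h => funext fun i => h.2 i (Nat.zero_le _), ?_⟩
  rintro rfl
  exact ⟨by simp, by simp⟩

theorem seqGF_zero (R a : ℕ) : seqGF R (ratioSeqs a 0) = 1 := by
  have h0 : evenIndexSum R 0 = 0 := by simp [evenIndexSum]
  have h1 : oddIndexSum R 0 = 0 := by simp [oddIndexSum]
  ext m
  rw [ratioSeqs_zero, MvPowerSeries.coeff_one]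
  change ({l | l ∈ ({0} : Set (ℕ → ℕ)) ∧ evenIndexSum R l = m 0 ∧
    oddIndexSum R l = m 1}.ncard : ℚ) = _
  split_ifs with hm
  · subst hm
    have : {l | l ∈ ({0} : Set (ℕ → ℕ)) ∧ evenIndexSum R l = (0 : Fin 2 →₀ ℕ) 0 ∧
        oddIndexSum R l = (0 : Fin 2 →₀ ℕ) 1} = {0} := by
      ext l
      simp only [Set.mem_singleton_iff, Set.mem_ofPred_eq, Finsupp.coe_zero, Pi.zero_apply,
        and_iff_left_iff_imp]
      rintro rfl
      exact ⟨h0, h1⟩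
    rw [this]
    simp
  · have : {l | l ∈ ({0} : Set (ℕ → ℕ)) ∧ evenIndexSum R l = m 0 ∧ oddIndexSum R l = m 1} = ∅ := by
      ext l
      simp only [Set.mem_singleton_iff, Set.mem_ofPred_eq, Set.mem_empty_iff_false, iff_false]
      rintro ⟨rfl, h, h'⟩
      refine hm ?_
      rw [← finsupp_fin_two_eq m, ← h, ← h', h0, h1]
      simp
    rw [this]
    simp

/-- The outer induction must keep `a` general, since length 2r+1 at `a` uses length 2r at `a + 1`;
the inner induction then raises `a` at length 2r+2. -/
theorem seqGF_even (R : ℕ) : ∀ r ≤ R, ∀ a,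
    seqGF (R + 1) (ratioSeqs a (2 * r)) * (qPoch (xVar * yVar) (xVar * yVar) r *
      qPoch xVar (xVar * yVar) r * qPoch (xVar ^ a * yVar ^ (a + 1)) (xVar * yVar) r) =
        qPoch ((xVar * yVar) ^ (a + r)) (xVar * yVar) r := by
  intro r
  induction r with
  | zero =>
    intro _ a
    simp [qPoch, seqGF_zero]
  | succ r ih =>
    intro hr a
    have ho := fun a => seqGF_odd_of_even (a := a) (by omega) (ih (by omega) (a + 1))
    induction a with
    | zero => exact seqGF_zero_even_of_odd hr (ho 1)
    | succ a iha => exact seqGF_succ_even hr (ho (a + 1)) iha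

theorem seqGF_odd {R r : ℕ} (hr : r ≤ R) (a : ℕ) :
    seqGF (R + 1) (ratioSeqs a (2 * r + 1)) * (qPoch (xVar * yVar) (xVar * yVar) r *
      qPoch xVar (xVar * yVar) (r + 1) * qPoch (xVar ^ a * yVar ^ (a + 1)) (xVar * yVar) r) =
        qPoch ((xVar * yVar) ^ (a + r + 1)) (xVar * yVar) r :=
  seqGF_odd_of_even hr (seqGF_even R r hr (a + 1))

theorem seqGF_ratioSeqs {n k : ℕ} (hk : k ≤ n + 1) :
    seqGF (k + 1) (ratioSeqs (n + 1 - k) k) * (qPoch (xVar * yVar) (xVar * yVar) (k / 2) *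
      qPoch xVar (xVar * yVar) ((k + 1) / 2) *
        qPoch (xVar ^ (n + 1 - k) * yVar ^ (n + 2 - k)) (xVar * yVar) (k / 2)) =
        qPoch ((xVar * yVar) ^ (n + 1 - k / 2)) (xVar * yVar) (k / 2) := by
  obtain ⟨r, hr | hr⟩ := Nat.even_or_odd' k
  · have h := seqGF_even k r (by omega) (n + 1 - k)
    rwa [← hr, show n + 1 - k + 1 = n + 2 - k by omega, show n + 1 - k + r = n + 1 - k / 2 by omega,
      show qPoch xVar (xVar * yVar) r = qPoch xVar (xVar * yVar) ((k + 1) / 2) by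
        rw [show (k + 1) / 2 = r by omega], show r = k / 2 by omega] at h
  · have h := seqGF_odd (R := k) (r := r) (by omega) (n + 1 - k)
    rwa [← hr, show n + 1 - k + 1 = n + 2 - k by omega,
      show n + 1 - k + r + 1 = n + 1 - k / 2 by omega,
      show r + 1 = (k + 1) / 2 by omega, show r = k / 2 by omega] at h

/-! ### Return to finite sequences and rational inequalities. -/

/-- Extend a finite sequence by zero. -/
def extendZero {k : ℕ} (l : Fin k → ℕ) (i : ℕ) : ℕ := if h : i < k then l ⟨i, h⟩ else 0

theorem extendZero_val {k : ℕ} (l : Fin k → ℕ) (i : Fin k) : extendZero l i = l i := by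
  simp [extendZero]

theorem extendZero_of_le {k i : ℕ} (l : Fin k → ℕ) (h : k ≤ i) : extendZero l i = 0 := by
  simp [extendZero, not_lt.2 h]

theorem sum_range_two_mul {M : Type*} [AddCommMonoid M] (f : ℕ → M) (R : ℕ) :
    ∑ i ∈ Finset.range (2 * R), f i = ∑ i ∈ Finset.range R, (f (2 * i) + f (2 * i + 1)) := by
  induction R with
  | zero => simp
  | succ R ih =>
    rw [mul_add, mul_one, Finset.sum_range_succ, Finset.sum_range_succ, ih, Finset.sum_range_succ,
      add_assoc]

theorem sum_fin_eq_sum_range_two_mul {k R : ℕ} (hk : k ≤ 2 * R) (f : ℕ → ℕ)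
    (hf : ∀ i, k ≤ i → f i = 0) :
    ∑ i : Fin k, f i = ∑ i ∈ Finset.range R, (f (2 * i) + f (2 * i + 1)) := by
  rw [← sum_range_two_mul, Fin.sum_univ_eq_sum_range]
  refine Finset.sum_subset (Finset.range_mono hk) fun i _ hi => hf i ?_
  simpa using hi

theorem evenIndexSum_extendZero {k R : ℕ} (hk : k ≤ 2 * R) (l : Fin k → ℕ) :
    evenIndexSum R (extendZero l) = oddWeight l := by
  have h := sum_fin_eq_sum_range_two_mul hk (fun i => if i % 2 = 0 then extendZero l i else 0)
    fun i hi => by simp [extendZero_of_le l hi]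
  simp only [extendZero_val] at h
  rw [oddWeight, h, evenIndexSum]
  exact Finset.sum_congr rfl fun i _ => by simp [Nat.add_mod]

theorem oddIndexSum_extendZero {k R : ℕ} (hk : k ≤ 2 * R) (l : Fin k → ℕ) :
    oddIndexSum R (extendZero l) = evenWeight l := by
  have h := sum_fin_eq_sum_range_two_mul hk (fun i => if i % 2 = 1 then extendZero l i else 0)
    fun i hi => by simp [extendZero_of_le l hi]
  simp only [extendZero_val] at h
  rw [evenWeight, h, oddIndexSum]
  exact Finset.sum_congr rfl fun i _ => by simp [Nat.add_mod]

theorem extendZero_mem_iff {n k : ℕ} (hk : k ≤ n + 1) (l : Fin k → ℕ) :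
    extendZero l ∈ ratioSeqs (n + 1 - k) k ↔ l ∈ truncAntiLectureHall n k := by
  obtain ⟨a, ha⟩ := Nat.exists_eq_add_of_le hk
  have hcast : (n : ℚ) - k + 1 = (a : ℚ) := by
    have : (n : ℚ) + 1 = k + a := by exact_mod_cast ha
    linarith
  rw [show n + 1 - k = a by omega]
  simp only [truncAntiLectureHall, hcast, Set.mem_ofPred_eq]
  have key : ∀ i j : Fin k, (j : ℕ) = i + 1 → (((a : ℚ) + (i : ℕ) ≠ 0 →
      (l j : ℚ) / ((a : ℚ) + (j : ℕ)) ≤ (l i : ℚ) / ((a : ℚ) + (i : ℕ))) ↔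
      l j * (a + i) ≤ l i * (a + i + 1)) := by
    intro i j hij
    -- If the denominator is zero, both forms are vacuous: the rational one by its guard, the
    -- cleared one because its left side is 0.
    rcases Nat.eq_zero_or_pos (a + (i : ℕ)) with h | h
    · have h' : (a : ℚ) + (i : ℕ) = 0 := by exact_mod_cast h
      simp [h, h']
    · have h' : (0 : ℚ) < (a : ℚ) + (i : ℕ) := by exact_mod_cast h
      rw [hij, Nat.cast_succ, ← add_assoc, div_le_div_iff₀ (by linarith) h']
      constructor
      · intro hh
        exact_mod_cast hh h'.ne'
      · intro hh _
        exact_mod_cast hh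
  constructor
  · intro h i j hij
    have := h.1 i
    rw [← hij, extendZero_val, extendZero_val] at this
    exact (key i j hij).2 this
  · refine fun h => ⟨fun i => ?_, fun i hi => extendZero_of_le l hi⟩
    by_cases hi : i + 1 < k
    · have := (key ⟨i, by omega⟩ ⟨i + 1, hi⟩ rfl).1 (h _ _ rfl)
      rwa [← extendZero_val l, ← extendZero_val l] at this
    · rw [extendZero_of_le l (not_lt.1 hi), zero_mul]
      exact Nat.zero_le _

theorem oddEvenGF_truncAntiLectureHall {n k : ℕ} (hk : k ≤ n + 1) :
    oddEvenGF (truncAntiLectureHall n k) = seqGF (k + 1) (ratioSeqs (n + 1 - k) k) := by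
  have hb : Set.BijOn extendZero (truncAntiLectureHall n k) (ratioSeqs (n + 1 - k) k) := by
    refine ⟨fun l hl => (extendZero_mem_iff hk l).2 hl, fun l _ m _ h => ?_, fun l hl => ?_⟩
    · funext i
      rw [← extendZero_val l, h, extendZero_val]
    · have e : extendZero (fun i : Fin k => l i) = l := by
        funext i
        by_cases hi : i < k
        · simp [extendZero, hi]
        · rw [extendZero_of_le _ (not_lt.1 hi), hl.2 i (not_lt.1 hi)]
      exact ⟨fun i => l i, (extendZero_mem_iff hk _).1 (by rwa [e]), e⟩
  exact (statGF_eq_of_bijOn hb (fun l _ => evenIndexSum_extendZero (by omega) l)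
    fun l _ => oddIndexSum_extendZero (by omega) l).symm

theorem oddEvenGF_truncAntiLectureHall_eq {n k : ℕ} (hk : k ≤ n + 1) :
    oddEvenGF (truncAntiLectureHall n k) =
      gaussBinom n (k / 2) (xVar * yVar) *
        (qPoch xVar (xVar * yVar) ((k + 1) / 2) *
          qPoch (xVar ^ (n + 1 - k) * yVar ^ (n + 2 - k)) (xVar * yVar) (k / 2))⁻¹ := by
  have hq : MvPowerSeries.constantCoeff (xVar * yVar) = 0 := by simp [constantCoeff_xVar]
  have h1 := constantCoeff_qPoch hq (q := xVar * yVar) (k / 2)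
  have h2 := constantCoeff_qPoch constantCoeff_xVar (q := xVar * yVar) ((k + 1) / 2)
  have h3 : MvPowerSeries.constantCoeff
      (qPoch (xVar ^ (n + 1 - k) * yVar ^ (n + 2 - k)) (xVar * yVar) (k / 2)) = 1 := by
    refine constantCoeff_qPoch ?_ _
    -- The exponent of x is 0 when k = n + 1, so the constant term is killed through y, whose
    -- exponent is always positive.
    rw [map_mul, map_pow, map_pow, constantCoeff_yVar, zero_pow (by omega), mul_zero]
  rw [MvPowerSeries.eq_mul_inv_iff_mul_eq (by rw [map_mul, h2, h3]; norm_num), gaussBinom,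
    MvPowerSeries.eq_mul_inv_iff_mul_eq (by rw [h1]; norm_num),
    oddEvenGF_truncAntiLectureHall hk, ← seqGF_ratioSeqs hk]
  ring

theorem truncAntiLectureHall_self (n : ℕ) : truncAntiLectureHall n n = antiLectureHall n := by
  ext l
  simp only [truncAntiLectureHall, antiLectureHall, sub_self, zero_add, Set.mem_ofPred_eq]
  refine forall₃_congr fun i j _ => ?_
  have h : (1 : ℚ) + (i : ℕ) ≠ 0 := by positivity
  rw [add_comm (1 : ℚ), add_comm (1 : ℚ)] at *
  exact ⟨fun hh => hh h, fun hh _ => hh⟩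

theorem mainTheorem4 :
    (∀ n k : ℕ, k ≤ n + 1 →
      oddEvenGF (truncAntiLectureHall n k) =
        gaussBinom n (k / 2) (xVar * yVar) *
          (qPoch xVar (xVar * yVar) ((k + 1) / 2) *
            qPoch (xVar ^ (n + 1 - k) * yVar ^ (n + 2 - k)) (xVar * yVar) (k / 2))⁻¹) ∧
    (∀ n : ℕ,
      oddEvenGF (antiLectureHall n) =
        gaussBinom n (n / 2) (xVar * yVar) *
          (qPoch xVar (xVar * yVar) ((n + 1) / 2) *
            qPoch (xVar * yVar ^ 2) (xVar * yVar) (n / 2))⁻¹) := by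
  refine ⟨fun n k hk => oddEvenGF_truncAntiLectureHall_eq hk, fun n => ?_⟩
  have h := oddEvenGF_truncAntiLectureHall_eq (n := n) (k := n) (Nat.le_succ n)
  rwa [truncAntiLectureHall_self, show n + 1 - n = 1 by omega, show n + 2 - n = 2 by omega,
    pow_one] at h
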